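/- A Liénard system of type $(m,n)$ is a planar system $\dot x=y,\ \dot y=-f(x)y-g(x)$ with real polynomials $f,g$, $\deg f=m$, $\deg g=n$ (in particular $f,g\neq 0$) and $g(0)=0$. A limit cycle of such a polynomial system is an isolated closed orbit; it is hyperelliptic if it is contained in an invariant algebraic curve of the form $(y+P(x))^2-Q(x)=0$ with $P,Q\in\mathbb R[x]$. (Here $F=0$ is invariant if $yF_x-(fy+g)F_y=KF$ for some $K\in\mathbb R[x,y]$.) Suppose that a Liénard system of type $(m,n)$ has $t$ (distinct) hyperelliptic limit cycles on the invariant curve $(y+P(x))^2-Q(x)=0$, where $Q\neq0$, and that each of them is the part of this curve in some strip $s_1\le x\le s_2$, $s_1<s_2$ (the strip depending on the cycle), such that (i) $f=P'+\dfrac{PQ'}{2Q}$ and $g=\dfrac{Q'(P^2-Q)}{2Q}$; (ii) all complex roots of $Q$ are real, $s_1,s_2$ are simple roots of $Q$, and $Q>0$ on $(s_1,s_2)$; (iii) $P^2-Q<0$ on $(s_1,s_2)$; (iv) if $\alpha\in(s_1,s_2)$ and $Q'(\alpha)=0$, then $f(\alpha)\neq0$. Then there exists a Liénard system of type $(m+1,n+2)$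 with at least $t$ hyperelliptic limit cycles. Moreover, it can be obtained as follows. For all sufficiently large real $s$, put $\tilde P=P(x)(x-s)$ and $\tilde Q=Q(x)(x-s)^2$. Then $F=\tilde P'+\dfrac{\tilde P\tilde Q'}{2\tilde Q}$ and $G=\dfrac{\tilde Q'(\tilde P^2-\tilde Q)}{2\tilde Q}$ are polynomials of degrees $m+1$ and $n+2$, the system $\dot x=y,\ \dot y=-F(x)y-G(x)$ has at least $t$ hyperelliptic limit cycles on the invariant curve $(y+\tilde P(x))^2-\tilde Q(x)=0$, and for some real $c$ the translated system with coefficients $F(x+c),\ G(x+c)$ is a Liénard system of type $(m+1,n+2)$ (that is, also $G(c)=0$). -/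

import Mathlib

/-! Liénard systems `x' = y`, `y' = -f(x) y - g(x)` and their hyperelliptic limit cycles. -/

namespace Lienard

/-- The coefficients `f`, `g` define a Liénard system of type `(m, n)`: the degrees are exactly
`m` and `n` (so both polynomials are nonzero), and `g` has no constant term. -/
def IsSystemOfType (m n : ℕ) (f g : Polynomial ℝ) : Prop :=
  f.degree = (m : WithBot ℕ) ∧ g.degree = (n : WithBot ℕ) ∧ g.eval 0 = 0

/-- The planar vector field `(y, -f(x) y - g(x))`. -/
def vectorField (f g : Polynomial ℝ) (p : ℝ × ℝ) : ℝ × ℝ :=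
  (p.2, -(f.eval p.1) * p.2 - g.eval p.1)

/-- A closed orbit: the range of a nonconstant periodic solution defined on all of `ℝ`. -/
def IsClosedOrbit (f g : Polynomial ℝ) (O : Set (ℝ × ℝ)) : Prop :=
  ∃ γ : ℝ → ℝ × ℝ, (∀ τ : ℝ, HasDerivAt γ (vectorField f g (γ τ)) τ) ∧
    (∃ T : ℝ, 0 < T ∧ Function.Periodic γ T) ∧ (∃ τ₁ τ₂ : ℝ, γ τ₁ ≠ γ τ₂) ∧ Set.range γ = O

/-- A limit cycle: an isolated closed orbit, i.e. one with a neighbourhood which contains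
no other closed orbit. -/
def IsLimitCycle (f g : Polynomial ℝ) (O : Set (ℝ × ℝ)) : Prop :=
  IsClosedOrbit f g O ∧
    ∃ U : Set (ℝ × ℝ), IsOpen U ∧ O ⊆ U ∧
      ∀ O' : Set (ℝ × ℝ), IsClosedOrbit f g O' → O' ⊆ U → O' = O

/-- A one-variable polynomial read as a polynomial in `x` (variable `0`) and `y` (variable `1`). -/
noncomputable def inX (p : Polynomial ℝ) : MvPolynomial (Fin 2) ℝ :=
  Polynomial.aeval (MvPolynomial.X 0) p

/-- The polynomial `F(x, y) = (y + P(x))² - Q(x)`; it is monic in `y`, hence never constant. -/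
noncomputable def hyperellipticPoly (P Q : Polynomial ℝ) : MvPolynomial (Fin 2) ℝ :=
  (MvPolynomial.X 1 + inX P) ^ 2 - inX Q

/-- The real zero set of a polynomial in two variables. -/
def zeroSet (F : MvPolynomial (Fin 2) ℝ) : Set (ℝ × ℝ) :=
  {p | MvPolynomial.eval ![p.1, p.2] F = 0}

/-- `F = 0` is invariant for the system: `y F_x - (f(x) y + g(x)) F_y = K F` for some
polynomial cofactor `K`. -/
def IsInvariantCurve (f g : Polynomial ℝ) (F : MvPolynomial (Fin 2) ℝ) : Prop :=
  ∃ K : MvPolynomial (Fin 2) ℝ,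
    MvPolynomial.X 1 * MvPolynomial.pderiv 0 F
      - (inX f * MvPolynomial.X 1 + inX g) * MvPolynomial.pderiv 1 F = K * F

/-- A limit cycle contained in the invariant hyperelliptic curve `(y + P(x))² - Q(x) = 0`. -/
def IsHyperellipticLimitCycleOn (f g P Q : Polynomial ℝ) (O : Set (ℝ × ℝ)) : Prop :=
  IsLimitCycle f g O ∧ IsInvariantCurve f g (hyperellipticPoly P Q) ∧
    O ⊆ zeroSet (hyperellipticPoly P Q)

/-- A hyperelliptic limit cycle: a limit cycle contained in some invariant hyperelliptic curve. -/
def IsHyperellipticLimitCycle (f g : Polynomial ℝ) (O : Set (ℝ × ℝ)) : Prop :=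
  ∃ P Q : Polynomial ℝ, IsHyperellipticLimitCycleOn f g P Q O

/-- The relations `f = P' + P Q' / (2 Q)` and `g = Q' (P² - Q) / (2 Q)`, denominators cleared. -/
def Relations (f g P Q : Polynomial ℝ) : Prop :=
  Q ≠ 0 ∧ 2 * Q * f = 2 * Q * P.derivative + P * Q.derivative ∧
    2 * Q * g = Q.derivative * (P ^ 2 - Q)

/-- The sufficient conditions (i)-(iv) on the strip `s₁ ≤ x ≤ s₂` for the part of
`(y + P(x))² - Q(x) = 0` in that strip to be a hyperelliptic limit cycle. -/
structure SufficientConditions (f g P Q : Polynomial ℝ) (s₁ s₂ : ℝ) : Prop where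
  lt : s₁ < s₂
  relations : Relations f g P Q
  roots_real : Q.Splits
  simple_left : Q.rootMultiplicity s₁ = 1
  simple_right : Q.rootMultiplicity s₂ = 1
  Q_pos : ∀ x ∈ Set.Ioo s₁ s₂, 0 < Q.eval x
  neg : ∀ x ∈ Set.Ioo s₁ s₂, (P ^ 2 - Q).eval x < 0
  f_ne : ∀ α ∈ Set.Ioo s₁ s₂, Q.derivative.eval α = 0 → f.eval α ≠ 0

/-- The part of the curve `(y + P(x))² - Q(x) = 0` in the strip `s₁ ≤ x ≤ s₂`. -/
def stripCurve (P Q : Polynomial ℝ) (s₁ s₂ : ℝ) : Set (ℝ × ℝ) :=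
  {p | p ∈ zeroSet (hyperellipticPoly P Q) ∧ p.1 ∈ Set.Icc s₁ s₂}

end Lienard

/-!
Write `A = (x - s₁)(s₂ - x)`. The conditions on a strip say that `P = A p` and `Q = A q` with
`q > 0` and `A p² < q` on `[s₁, s₂]` (`IsOval`). With the abscissa
`x = (s₁ + s₂) / 2 - (s₂ - s₁) / 2 · cos θ` and `w = dx/dθ`, one has `A(x) = w²`, so the part of the
curve `(y + P)² = Q` in the strip is the smooth closed curve `y = w (√q - w p)`, and it is a periodic
orbit which runs through the angle `θ` with the positive speed `√q - w p`.

Isolation comes from the cofactor `κ = 2 P' - 2 f` of the invariant curve: the function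
`V = (y + P)² - Q` satisfies `V' = κ V` along trajectories. If the integral of `κ` over a period of
the oval is not zero, then by Grönwall's inequality it is not zero, with the same sign, over each time
interval of the same length along a trajectory that stays near the oval. So `|V|` is expanded, or
contracted, by each such step, and a periodic trajectory near the oval must have `V = 0`, that is, lie
on the oval (`exists_isOpen_forall_periodic_eq_zero`, `IsOval.isLimitCycle`).

Replacing `P`, `Q` by `P (x - s)`, `Q (x - s)²` with `s > s₂` keeps the oval conditions. With `κ` the
old cofactor, the integral of the new one is `-∫ κ / σ dθ - 2 ∫ (P / σ) / (s - x) dθ` with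
`σ = √q + w p > 0`. If it had arbitrarily large zeros `s`, all its expansion coefficients at infinity would vanish, so that `P / σ`
would be orthogonal to all polynomials in `x`, in particular to `P`; but `∫ P² / σ dθ > 0`. So the
integral is nonzero for all large `s` (`IsOval.eventually_integral_ne_zero`).

The remaining claims are algebra. Invariance of the curve is equivalent to the relations between `f`,
`g`, `P`, `Q`; these give `F = (x - s) f + 2 P` and `G = (x - s)² g + (x - s)(P² - Q)`, whose
degrees follow because there is no cancellation between leading terms, and `G` vanishes at `s`.
-/

namespace Lienard

open Polynomial Filter Topology

/-! ### Invariant curves, coefficient relations and degrees -/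

@[simp] lemma eval_inX (p : ℝ[X]) (x y : ℝ) :
    MvPolynomial.eval ![x, y] (inX p) = p.eval x := by
  unfold inX
  induction p using Polynomial.induction_on' with
  | add p q hp hq => simp [hp, hq]
  | monomial n a => simp [Polynomial.aeval_monomial]

lemma mem_zeroSet_hyperellipticPoly (P Q : ℝ[X]) (z : ℝ × ℝ) :
    z ∈ zeroSet (hyperellipticPoly P Q) ↔ (z.2 + P.eval z.1) ^ 2 - Q.eval z.1 = 0 := by
  simp [zeroSet, hyperellipticPoly]

lemma pderiv_zero_inX (p : ℝ[X]) : MvPolynomial.pderiv 0 (inX p) = inX p.derivative := by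
  simp [inX, Derivation.map_aeval]

lemma pderiv_one_inX (p : ℝ[X]) : MvPolynomial.pderiv 1 (inX p) = 0 := by
  simp [inX, Derivation.map_aeval]

lemma pderiv_zero_hyperellipticPoly (P Q : ℝ[X]) :
    MvPolynomial.pderiv 0 (hyperellipticPoly P Q) =
      2 * (MvPolynomial.X 1 + inX P) * inX P.derivative - inX Q.derivative := by
  simp [hyperellipticPoly, pderiv_zero_inX, Derivation.leibniz_pow]
  ring

lemma pderiv_one_hyperellipticPoly (P Q : ℝ[X]) :
    MvPolynomial.pderiv 1 (hyperellipticPoly P Q) = 2 * (MvPolynomial.X 1 + inX P) := by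
  simp [hyperellipticPoly, pderiv_one_inX, Derivation.leibniz_pow]
  ring

lemma aeval_inX (p : ℝ[X]) (x : ℝ) :
    MvPolynomial.aeval ![C x, (X : ℝ[X])] (inX p) = C (p.eval x) := by
  unfold inX
  induction p using Polynomial.induction_on' with
  | add p q hp hq => simp [hp, hq]
  | monomial n a => simp [Polynomial.aeval_monomial]

/-- The second coefficient relation with the denominator divided out. -/
lemma Relations.two_mul_g {f g P Q : ℝ[X]} (h : Relations f g P Q) :
    2 * g = 2 * f * P - 2 * P * P.derivative - Q.derivative := by
  obtain ⟨hQ, h1, h2⟩ := h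
  apply mul_left_cancel₀ hQ
  linear_combination h2 - P * h1

lemma eq_zero_of_C_mul_X_add_C {a b : ℝ} (h : C a * X + C b = 0) : a = 0 ∧ b = 0 := by
  have h0 := congrArg (fun p => coeff p 0) h
  have h1 := congrArg (fun p => coeff p 1) h
  simp only [coeff_add, coeff_C_mul, coeff_X_zero, coeff_X_one, coeff_C_zero, coeff_C_succ,
    mul_zero, zero_add, mul_one, add_zero, coeff_zero] at h0 h1
  exact ⟨h1, h0⟩

/-- Reducing the invariance identity modulo the curve, which is monic of degree two in `y`,
leaves a polynomial of degree at most one in `y`, whose two coefficients must vanish. -/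
lemma relations_of_isInvariantCurve {f g P Q : ℝ[X]} (hQ : Q ≠ 0)
    (h : IsInvariantCurve f g (hyperellipticPoly P Q)) : Relations f g P Q := by
  obtain ⟨K, hK⟩ := h
  rw [pderiv_zero_hyperellipticPoly, pderiv_one_hyperellipticPoly, hyperellipticPoly] at hK
  have key : ∀ x : ℝ,
      (2 * f * P - 2 * P * P.derivative - Q.derivative - 2 * g).eval x = 0 ∧
      (-2 * g * P - (2 * P.derivative - 2 * f) * (P ^ 2 - Q)).eval x = 0 := by
    intro x
    have hx := congrArg (MvPolynomial.aeval ![C x, (X : ℝ[X])]) hK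
    simp only [map_sub, map_mul, map_add, map_pow, aeval_inX, MvPolynomial.aeval_X, map_ofNat,
      Matrix.cons_val_one, Matrix.cons_val_fin_one] at hx
    set a := P.eval x
    set a' := P.derivative.eval x
    set b := Q.eval x
    set b' := Q.derivative.eval x
    set c := f.eval x
    set d := g.eval x
    set κ := MvPolynomial.aeval ![C x, (X : ℝ[X])] K
    have hdvd : (X + C a) ^ 2 - C b ∣
        C (2 * c * a - 2 * a * a' - b' - 2 * d) * X
          + C (-2 * d * a - (2 * a' - 2 * c) * (a ^ 2 - b)) := by
      refine ⟨κ - C (2 * a' - 2 * c), ?_⟩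
      simp only [C_mul, C_sub, C_neg, C_pow, C_ofNat]
      linear_combination hx
    have hzero := eq_zero_of_dvd_of_degree_lt hdvd (by
      have h2 : ((X + C a) ^ 2 - C b).degree = 2 := by compute_degree!
      rw [h2]
      exact lt_of_le_of_lt degree_linear_le (by norm_num))
    obtain ⟨h1, h0⟩ := eq_zero_of_C_mul_X_add_C hzero
    simp only [eval_sub, eval_mul, eval_pow, eval_neg, eval_ofNat]
    exact ⟨h1, h0⟩
  have h1 : 2 * f * P - 2 * P * P.derivative - Q.derivative - 2 * g = 0 :=
    Polynomial.funext fun x => by simpa using (key x).1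
  have h0 : -2 * g * P - (2 * P.derivative - 2 * f) * (P ^ 2 - Q) = 0 :=
    Polynomial.funext fun x => by simpa using (key x).2
  have hf : 2 * Q * f = 2 * Q * P.derivative + P * Q.derivative := by
    linear_combination - h0 + P * h1
  exact ⟨hQ, hf, by linear_combination P * hf - Q * h1⟩

/-- The cofactor is `2 P' - 2 f`. -/
lemma Relations.isInvariantCurve {f g P Q : ℝ[X]} (h : Relations f g P Q) :
    IsInvariantCurve f g (hyperellipticPoly P Q) := by
  have hf := congrArg inX h.2.1
  have hg := congrArg inX h.two_mul_g
  refine ⟨inX (2 * P.derivative - 2 * f), ?_⟩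
  rw [pderiv_zero_hyperellipticPoly, pderiv_one_hyperellipticPoly, hyperellipticPoly]
  simp only [inX, map_sub, map_mul, map_add, map_ofNat] at hf hg ⊢
  linear_combination - (MvPolynomial.X 1 + aeval (MvPolynomial.X 0) P) * hg - hf

lemma coeff_mul_derivative_of_natDegree_le {P Q : ℝ[X]} {a b : ℕ} (hP : P.natDegree ≤ a + 1)
    (hQ : Q.natDegree ≤ b) :
    (P * Q.derivative).coeff (a + b) = b * (P.coeff (a + 1) * Q.coeff b) := by
  obtain _ | b := b
  · rw [natDegree_eq_zero.1 (Nat.le_zero.1 hQ) |>.choose_spec.symm]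
    simp
  · have h1 : Q.derivative.natDegree ≤ b := (natDegree_derivative_le Q).trans (by omega)
    rw [show a + (b + 1) = (a + 1) + b by ring, coeff_mul_add_eq_of_natDegree_le hP h1,
      coeff_derivative]
    push_cast
    ring

/-- The leading terms of `2 Q f = 2 Q P' + P Q'`: there is no cancellation on the right. -/
lemma Relations.coeff_f {f g P Q : ℝ[X]} (h : Relations f g P Q) {m : ℕ}
    (hf : f.degree = (m : WithBot ℕ)) :
    P.natDegree = m + 1 ∧
      2 * f.coeff m = (2 * (m + 1) + Q.natDegree) * P.coeff (m + 1) := by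
  obtain ⟨hQ, h1, -⟩ := h
  have hf0 : f ≠ 0 := fun h => by simp [h] at hf
  have hfm : f.natDegree = m := natDegree_eq_of_degree_eq_some hf
  have hQf : (2 * Q * f).natDegree = Q.natDegree + m := by
    rw [mul_assoc, show (2 : ℝ[X]) = C 2 from rfl, natDegree_C_mul two_ne_zero,
      natDegree_mul hQ hf0, hfm]
  have hQf0 : 2 * Q * f ≠ 0 := mul_ne_zero (mul_ne_zero two_ne_zero hQ) hf0
  have hlQ : Q.coeff Q.natDegree ≠ 0 := by simpa using hQ
  obtain hd | ⟨e, he⟩ : P.natDegree = 0 ∨ ∃ e, P.natDegree = e + 1 := by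
    rcases P.natDegree with _ | e
    · simp
    · exact Or.inr ⟨e, rfl⟩
  · -- for constant `P` the right-hand side `P Q'` has too small a degree
    exfalso
    obtain ⟨p, rfl⟩ := natDegree_eq_zero.1 hd
    rw [derivative_C, mul_zero, zero_add] at h1
    have hle : (2 * Q * f).natDegree ≤ Q.natDegree - 1 := by
      rw [h1]
      exact (natDegree_C_mul_le _ _).trans (natDegree_derivative_le Q)
    have hq : Q.natDegree = 0 := by omega
    obtain ⟨r, rfl⟩ := natDegree_eq_zero.1 hq
    rw [h1] at hQf0
    simp at hQf0
  · have hP' : P.derivative.natDegree ≤ e := (natDegree_derivative_le P).trans (by omega)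
    have hcoeff : (2 * Q * f).coeff (e + Q.natDegree) =
        (2 * (e + 1) + Q.natDegree) * (P.coeff (e + 1) * Q.coeff Q.natDegree) := by
      rw [h1, coeff_add, coeff_mul_derivative_of_natDegree_le he.le le_rfl, mul_assoc,
        show (2 : ℝ[X]) = C 2 from rfl, coeff_C_mul, add_comm e,
        coeff_mul_add_eq_of_natDegree_le le_rfl hP', coeff_derivative]
      ring
    have hlP : P.coeff (e + 1) ≠ 0 := by
      rw [← he]
      have : P ≠ 0 := fun h => by simp [h] at he
      simpa using this
    have hle : (2 * Q * f).natDegree ≤ e + Q.natDegree := by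
      rw [h1]
      refine natDegree_add_le_of_degree_le ?_ ?_
      · rw [mul_assoc, show (2 : ℝ[X]) = C 2 from rfl]
        refine (natDegree_C_mul_le _ _).trans (natDegree_mul_le.trans ?_)
        omega
      · obtain hq | hq := Nat.eq_zero_or_pos Q.natDegree
        · obtain ⟨r, hr⟩ := natDegree_eq_zero.1 hq
          rw [← hr]
          simp
        · refine natDegree_mul_le.trans ?_
          have := natDegree_derivative_le Q
          omega
    -- both leading terms on the right have the sign of that of `P Q`
    have hge : e + Q.natDegree ≤ (2 * Q * f).natDegree := by
      apply le_natDegree_of_ne_zero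
      rw [hcoeff]
      have : (0 : ℝ) < 2 * (e + 1) + Q.natDegree := by positivity
      exact mul_ne_zero this.ne' (mul_ne_zero hlP hlQ)
    have hem : e = m := by omega
    subst hem
    refine ⟨he, mul_left_cancel₀ hlQ ?_⟩
    have h2 : (2 * Q * f).coeff (e + Q.natDegree) = 2 * (Q.coeff Q.natDegree * f.coeff e) := by
      rw [mul_assoc, show (2 : ℝ[X]) = C 2 from rfl, coeff_C_mul, add_comm e,
        coeff_mul_add_eq_of_natDegree_le le_rfl hfm.le]
    linear_combination hcoeff - h2

/-- The leading terms of `2 Q g = Q' (P² - Q)`. -/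
lemma Relations.coeff_g {f g P Q : ℝ[X]} (h : Relations f g P Q) {n : ℕ}
    (hg : g.degree = (n : WithBot ℕ)) :
    (P ^ 2 - Q).natDegree = n + 1 ∧
      2 * g.coeff n = Q.natDegree * (P ^ 2 - Q).coeff (n + 1) := by
  obtain ⟨hQ, -, h2⟩ := h
  have hg0 : g ≠ 0 := fun h => by simp [h] at hg
  have hgn : g.natDegree = n := natDegree_eq_of_degree_eq_some hg
  have hQg : (2 * Q * g).natDegree = Q.natDegree + n := by
    rw [mul_assoc, show (2 : ℝ[X]) = C 2 from rfl, natDegree_C_mul two_ne_zero,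
      natDegree_mul hQ hg0, hgn]
  have hQg0 : 2 * Q * g ≠ 0 := mul_ne_zero (mul_ne_zero two_ne_zero hQ) hg0
  have hlQ : Q.coeff Q.natDegree ≠ 0 := by simpa using hQ
  have hQ' : Q.derivative ≠ 0 := fun h => hQg0 (by rw [h2, h, zero_mul])
  have hR : P ^ 2 - Q ≠ 0 := fun h => hQg0 (by rw [h2, h, mul_zero])
  have hq : Q.natDegree ≠ 0 := fun h => hQ' (derivative_of_natDegree_zero h)
  have hdeg : (P ^ 2 - Q).natDegree = n + 1 := by
    have h3 : (2 * Q * g).natDegree = Q.natDegree - 1 + (P ^ 2 - Q).natDegree := by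
      rw [h2, natDegree_mul hQ' hR, natDegree_derivative]
    omega
  refine ⟨hdeg, mul_left_cancel₀ hlQ ?_⟩
  have h3 : (2 * Q * g).coeff (n + Q.natDegree) = 2 * (Q.coeff Q.natDegree * g.coeff n) := by
    rw [mul_assoc, show (2 : ℝ[X]) = C 2 from rfl, coeff_C_mul, add_comm n,
      coeff_mul_add_eq_of_natDegree_le le_rfl hgn.le]
  rw [h2, mul_comm, coeff_mul_derivative_of_natDegree_le hdeg.le le_rfl] at h3
  linear_combination -h3

lemma degree_X_sub_C_mul_add {f R : ℝ[X]} {m : ℕ} (s : ℝ) (hf : f.natDegree ≤ m)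
    (hR : R.natDegree ≤ m + 1) (h : f.coeff m + R.coeff (m + 1) ≠ 0) :
    ((X - C s) * f + R).degree = ((m + 1 : ℕ) : WithBot ℕ) := by
  have hX : (X - C s : ℝ[X]).natDegree ≤ 1 := (natDegree_X_sub_C s).le
  refine le_antisymm (degree_le_of_natDegree_le (natDegree_add_le_of_degree_le
    (natDegree_mul_le.trans (by omega)) hR)) (le_degree_of_ne_zero ?_)
  rw [coeff_add, add_comm m 1, coeff_mul_add_eq_of_natDegree_le hX hf, add_comm 1 m]
  simpa using h

/-- The leading coefficients of `f` and `P` have the same sign, so that they do not cancel. -/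
lemma Relations.degree_damping {f g P Q : ℝ[X]} (h : Relations f g P Q) {m : ℕ}
    (hf : f.degree = (m : WithBot ℕ)) (s : ℝ) :
    ((X - C s) * f + 2 * P).degree = ((m + 1 : ℕ) : WithBot ℕ) := by
  obtain ⟨hP, hc⟩ := h.coeff_f hf
  have hlP : P.coeff (m + 1) ≠ 0 := by
    rw [← hP]
    have : P ≠ 0 := fun h => by simp [h] at hP
    simpa using this
  rw [show (2 : ℝ[X]) = C 2 from rfl]
  refine degree_X_sub_C_mul_add s (natDegree_eq_of_degree_eq_some hf).le
    ((natDegree_C_mul_le _ _).trans hP.le) ?_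
  rw [coeff_C_mul]
  have : (0 : ℝ) < m + 1 + Q.natDegree / 2 + 2 := by positivity
  have h2 := mul_ne_zero this.ne' hlP
  intro h0
  apply h2
  linear_combination h0 - hc / 2

/-- The leading coefficients of `g` and `P² - Q` have the same sign, so that they do not cancel. -/
lemma Relations.degree_restoring {f g P Q : ℝ[X]} (h : Relations f g P Q) {n : ℕ}
    (hg : g.degree = (n : WithBot ℕ)) (s : ℝ) :
    ((X - C s) ^ 2 * g + (X - C s) * (P ^ 2 - Q)).degree = ((n + 2 : ℕ) : WithBot ℕ) := by
  obtain ⟨hR, hc⟩ := h.coeff_g hg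
  have hlR : (P ^ 2 - Q).coeff (n + 1) ≠ 0 := by
    rw [← hR]
    have : P ^ 2 - Q ≠ 0 := fun h => by simp [h] at hR
    simpa using this
  rw [show (X - C s) ^ 2 * g + (X - C s) * (P ^ 2 - Q)
      = (X - C s) * ((X - C s) * g + (P ^ 2 - Q)) by ring, degree_mul, degree_X_sub_C,
    degree_X_sub_C_mul_add s (natDegree_eq_of_degree_eq_some hg).le hR.le]
  · norm_cast
    omega
  · have : (0 : ℝ) < Q.natDegree / 2 + 1 := by positivity
    have h2 := mul_ne_zero this.ne' hlR
    intro h0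
    apply h2
    linear_combination h0 - hc / 2

lemma Relations.translated {f g P Q : ℝ[X]} (h : Relations f g P Q) (c : ℝ) :
    Relations (f.comp (X + C c)) (g.comp (X + C c)) (P.comp (X + C c)) (Q.comp (X + C c)) := by
  obtain ⟨hQ, h1, h2⟩ := h
  have h1' := congrArg (fun p => p.comp (X + C c)) h1
  have h2' := congrArg (fun p => p.comp (X + C c)) h2
  simp only [mul_comp, add_comp, sub_comp, pow_comp, ofNat_comp] at h1' h2'
  refine ⟨?_, ?_, ?_⟩
  · intro h0
    apply hQ
    have := congrArg (fun p => p.comp (X - C c)) h0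
    simpa [comp_assoc] using this
  · simpa [derivative_comp] using h1'
  · simpa [derivative_comp] using h2'

/-- The coefficients of the new system, as polynomials: the logarithmic derivative of
`Q (x - s)²` is `Q' / Q + 2 / (x - s)`. -/
lemma Relations.mul_linear {f g P Q : ℝ[X]} (h : Relations f g P Q) (s : ℝ) :
    Relations ((X - C s) * f + 2 * P) ((X - C s) ^ 2 * g + (X - C s) * (P ^ 2 - Q))
      (P * (X - C s)) (Q * (X - C s) ^ 2) := by
  obtain ⟨hQ, h1, h2⟩ := h
  refine ⟨mul_ne_zero hQ (pow_ne_zero _ (X_sub_C_ne_zero s)), ?_, ?_⟩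
  · simp only [derivative_mul, derivative_pow, derivative_sub, derivative_X, derivative_C]
    simp only [Nat.cast_ofNat, C_ofNat, Nat.add_one_sub_one, pow_one]
    linear_combination (X - C s) ^ 3 * h1
  · simp only [derivative_mul, derivative_pow, derivative_sub, derivative_X, derivative_C]
    simp only [Nat.cast_ofNat, C_ofNat, Nat.add_one_sub_one, pow_one]
    linear_combination (X - C s) ^ 4 * h2

/-! ### Isolation of a periodic orbit by a function with a cofactor -/

section Isolation

variable {E : Type*} [NormedAddCommGroup E] [NormedSpace ℝ E]

lemma exists_lipschitzOnWith_closedBall {E : Type*} [NormedAddCommGroup E] [ProperSpace E]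
    {F : Type*} [PseudoMetricSpace F] {v : E → F} (hv : LocallyLipschitz v) (R : ℝ) :
    ∃ L, LipschitzOnWith L v (Metric.closedBall 0 R) :=
  hv.locallyLipschitzOn.exists_lipschitzOnWith_of_compact (isCompact_closedBall 0 R)

/-- Along a trajectory, `V' = κ V` integrates to an exponential factor. -/
lemma eq_mul_exp_integral {w k : ℝ → ℝ} (hk : Continuous k)
    (hw : ∀ τ, HasDerivAt w (k τ * w τ) τ) (a b : ℝ) :
    w b = w a * Real.exp (∫ τ in a..b, k τ) := by
  have hI : ∀ τ, HasDerivAt (fun t => ∫ σ in a..t, k σ) (k τ) τ := fun τ =>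
    intervalIntegral.integral_hasDerivAt_right (hk.intervalIntegrable _ _)
      (hk.stronglyMeasurableAtFilter _ _) hk.continuousAt
  have hconst : ∀ τ, HasDerivAt (fun t => w t * Real.exp (-∫ σ in a..t, k σ)) 0 τ := by
    intro τ
    refine ((hw τ).mul (hI τ).neg.exp).congr_deriv ?_
    ring
  have := is_const_of_deriv_eq_zero (fun τ => (hconst τ).differentiableAt)
    (fun τ => (hconst τ).deriv) b a
  simp only [intervalIntegral.integral_same, neg_zero, Real.exp_zero, mul_one] at this
  rw [← this, mul_assoc, ← Real.exp_add]
  simp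

/-- A continuous periodic function satisfying `w (a + T) = w a * exp (J a)`, where `J` has a
constant sign, vanishes: compare with the maximum of `|w|`. -/
lemma eq_zero_of_periodic_of_mul_exp {w J : ℝ → ℝ} {T T' I : ℝ} (hw : Continuous w)
    (hT' : 0 < T') (hper : Function.Periodic w T') (hI : I ≠ 0)
    (hJ : ∀ a, |J a - I| < |I|) (hstep : ∀ a, w (a + T) = w a * Real.exp (J a)) (τ : ℝ) :
    w τ = 0 := by
  obtain ⟨b, hb⟩ : ∃ b, ∀ a, |w a| ≤ |w b| := by
    have hcomp := hper.compact_of_continuous hT'.ne' hw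
    obtain ⟨_, ⟨b, rfl⟩, hb⟩ := hcomp.exists_isMaxOn (Set.range_nonempty w)
      continuous_abs.continuousOn
    exact ⟨b, fun a => hb ⟨a, rfl⟩⟩
  have habs : ∀ a, |w (a + T)| = |w a| * Real.exp (J a) := fun a => by
    rw [hstep, abs_mul, abs_of_pos (Real.exp_pos _)]
  suffices h : |w b| ≤ 0 by
    have := (hb τ).trans h
    simpa using this
  by_contra! hpos
  rcases lt_or_gt_of_ne hI with hneg | hIpos
  · -- the factor is less than one: step onto the maximum
    have hJneg : J (b - T) < 0 := by
      have := abs_lt.1 (hJ (b - T))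
      rw [abs_of_neg hneg] at this
      linarith
    have h1 := habs (b - T)
    rw [sub_add_cancel] at h1
    have h2 := hb (b - T)
    have h3 := Real.exp_lt_one_iff.2 hJneg
    nlinarith [abs_nonneg (w (b - T)), Real.exp_pos (J (b - T))]
  · -- the factor exceeds one: step away from the maximum
    have hJpos : 0 < J b := by
      have := abs_lt.1 (hJ b)
      rw [abs_of_pos hIpos] at this
      linarith
    have h1 := habs b
    have h2 := hb (b + T)
    have h3 := Real.one_lt_exp_iff.2 hJpos
    nlinarith

/-- If a function `V` satisfies `V' = κ V` along all trajectories, and `κ` has a nonzero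
integral over one period of a periodic trajectory `γ`, then `V` vanishes along all periodic
trajectories near `γ`. By Grönwall's inequality, a trajectory that stays near `γ` shadows `γ` over
each time interval of length `T`, so that `V` is multiplied by a factor that is uniformly
larger, or uniformly smaller, than `1`. -/
theorem exists_isOpen_forall_periodic_eq_zero [ProperSpace E] {v : E → E} {κ V : E → ℝ}
    (hv : LocallyLipschitz v) (hκ : LocallyLipschitz κ) (hV : Continuous V)
    (hder : ∀ γ : ℝ → E, (∀ τ, HasDerivAt γ (v (γ τ)) τ) →
      ∀ τ, HasDerivAt (fun t => V (γ t)) (κ (γ τ) * V (γ τ)) τ)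
    {γ : ℝ → E} (hγ : ∀ τ, HasDerivAt γ (v (γ τ)) τ) {T : ℝ} (hT : 0 < T)
    (hper : Function.Periodic γ T) (hI : ∫ τ in 0..T, κ (γ τ) ≠ 0) :
    ∃ U : Set E, IsOpen U ∧ Set.range γ ⊆ U ∧
      ∀ γ' : ℝ → E, (∀ τ, HasDerivAt γ' (v (γ' τ)) τ) →
        (∃ T' : ℝ, 0 < T' ∧ Function.Periodic γ' T') → Set.range γ' ⊆ U →
        ∀ τ, V (γ' τ) = 0 := by
  have hγc : Continuous γ := continuous_iff_continuousAt.2 fun τ => (hγ τ).continuousAt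
  set I := ∫ τ in 0..T, κ (γ τ) with hIdef
  obtain ⟨R, hR⟩ : ∃ R, ∀ τ, ‖γ τ‖ ≤ R := by
    obtain ⟨R, hR⟩ := (hper.isBounded_of_continuous hT.ne' hγc).exists_norm_le
    exact ⟨R, fun τ => hR _ ⟨τ, rfl⟩⟩
  obtain ⟨L, hL⟩ := exists_lipschitzOnWith_closedBall hv (R + 1)
  obtain ⟨M, hM⟩ := exists_lipschitzOnWith_closedBall hκ (R + 1)
  obtain ⟨δ, hδ0, hδ1, hδ⟩ : ∃ δ : ℝ, 0 < δ ∧ δ ≤ 1 ∧ M * (δ * Real.exp (L * T)) * T < |I| := by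
    set D := M * Real.exp (L * T) * T with hD
    have hD0 : 0 ≤ D := by positivity
    have hIpos : 0 < |I| := abs_pos.2 hI
    refine ⟨min 1 (|I| / (D + 1)), by positivity, min_le_left _ _, ?_⟩
    calc M * (min 1 (|I| / (D + 1)) * Real.exp (L * T)) * T
        = D * min 1 (|I| / (D + 1)) := by rw [hD]; ring
      _ ≤ D * (|I| / (D + 1)) := by gcongr; exact min_le_right _ _
      _ < |I| := by
        rw [mul_div_assoc', div_lt_iff₀ (by positivity)]
        nlinarith
  refine ⟨Metric.thickening δ (Set.range γ), Metric.isOpen_thickening,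
    Metric.self_subset_thickening hδ0 _, ?_⟩
  rintro γ' hγ' ⟨T', hT', hper'⟩ hsub
  have hγ'c : Continuous γ' := continuous_iff_continuousAt.2 fun τ => (hγ' τ).continuousAt
  have hnear : ∀ a, ∃ t₀, dist (γ' a) (γ t₀) < δ := by
    intro a
    obtain ⟨_, ⟨t₀, rfl⟩, h⟩ := Metric.mem_thickening_iff.1 (hsub ⟨a, rfl⟩)
    exact ⟨t₀, h⟩
  have hball : ∀ τ, γ τ ∈ Metric.closedBall (0 : E) (R + 1) := fun τ => by
    simpa using (hR τ).trans (by linarith)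
  have hball' : ∀ τ, γ' τ ∈ Metric.closedBall (0 : E) (R + 1) := fun τ => by
    obtain ⟨t₀, h⟩ := hnear τ
    rw [mem_closedBall_zero_iff]
    have h1 : ‖γ' τ‖ ≤ ‖γ' τ - γ t₀‖ + ‖γ t₀‖ := by simpa using norm_add_le (γ' τ - γ t₀) (γ t₀)
    rw [← dist_eq_norm] at h1
    linarith [hR t₀]
  have hshift : ∀ {c : ℝ → E}, (∀ τ, HasDerivAt c (v (c τ)) τ) → ∀ a τ,
      HasDerivAt (fun t => c (t + a)) (v (c (τ + a))) τ :=
    fun h a τ => (h (τ + a)).comp_add_const τ a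
  refine eq_zero_of_periodic_of_mul_exp (w := fun τ => V (γ' τ)) (T := T)
    (J := fun a => ∫ τ in a..a + T, κ (γ' τ)) (hV.comp hγ'c) hT' (hper'.comp V) hI ?_ ?_
  · intro a
    obtain ⟨t₀, ht₀⟩ := hnear a
    have hgron : ∀ τ ∈ Set.Icc 0 T, dist (γ' (τ + a)) (γ (τ + t₀)) ≤ δ * Real.exp (L * T) := by
      intro τ hτ
      have h := dist_le_of_trajectories_ODE_of_mem (v := fun _ => v)
        (s := fun _ => Metric.closedBall 0 (R + 1)) (a := 0) (b := T) (δ := δ)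
        (f := fun t => γ' (t + a)) (g := fun t => γ (t + t₀)) (fun _ _ => hL)
        (by fun_prop) (fun t _ => (hshift hγ' a t).hasDerivWithinAt) (fun t _ => hball' _)
        (by fun_prop) (fun t _ => (hshift hγ t₀ t).hasDerivWithinAt) (fun t _ => hball _)
        (by simpa using ht₀.le) τ hτ
      refine h.trans ?_
      have : τ - 0 ≤ T := by simpa using hτ.2
      gcongr
    have hIt : I = ∫ τ in 0..T, κ (γ (τ + t₀)) := by
      rw [intervalIntegral.integral_comp_add_right (fun τ => κ (γ τ)), zero_add, add_comm T,
        hIdef]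
      have := (hper.comp κ).intervalIntegral_add_eq 0 t₀
      simpa using this
    have hJt : ∫ τ in a..a + T, κ (γ' τ) = ∫ τ in 0..T, κ (γ' (τ + a)) := by
      rw [intervalIntegral.integral_comp_add_right (fun τ => κ (γ' τ)), zero_add, add_comm T]
    have hκc := hκ.continuous
    have hc1 : Continuous fun τ => κ (γ' (τ + a)) := by fun_prop
    have hc2 : Continuous fun τ => κ (γ (τ + t₀)) := by fun_prop
    rw [hJt, hIt, ← intervalIntegral.integral_sub (hc1.intervalIntegrable _ _)
      (hc2.intervalIntegrable _ _), ← hIt]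
    refine lt_of_le_of_lt ?_ hδ
    rw [← Real.norm_eq_abs]
    have hbd := intervalIntegral.norm_integral_le_of_norm_le_const (a := 0) (b := T)
      (f := fun τ => κ (γ' (τ + a)) - κ (γ (τ + t₀))) (C := M * (δ * Real.exp (L * T))) ?_
    · rwa [sub_zero, abs_of_pos hT] at hbd
    · intro τ hτ
      rw [Set.uIoc_of_le hT.le] at hτ
      rw [← dist_eq_norm]
      refine (hM.dist_le_mul _ (hball' _) _ (hball _)).trans ?_
      gcongr
      exact hgron τ ⟨hτ.1.le, hτ.2⟩
  · intro a
    exact eq_mul_exp_integral (w := fun τ => V (γ' τ)) (hκ.continuous.comp hγ'c)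
      (hder γ' hγ') a (a + T)

/-- Two bounded solutions that meet have the same range. -/
lemma range_eq_of_meet [ProperSpace E] {v : E → E} (hv : LocallyLipschitz v) {γ γ' : ℝ → E}
    (hγ : ∀ τ, HasDerivAt γ (v (γ τ)) τ) (hγ' : ∀ τ, HasDerivAt γ' (v (γ' τ)) τ) {R : ℝ}
    (hb : ∀ τ, ‖γ τ‖ ≤ R) (hb' : ∀ τ, ‖γ' τ‖ ≤ R) {t t' : ℝ} (h : γ' t' = γ t) :
    Set.range γ' = Set.range γ := by
  obtain ⟨L, hL⟩ := exists_lipschitzOnWith_closedBall hv R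
  have heq : (fun τ => γ' (τ + (t' - t))) = γ := by
    refine ODE_solution_unique_univ (v := fun _ => v) (s := fun _ => Metric.closedBall 0 R)
      (t₀ := t) (fun _ => hL) (fun τ => ⟨(hγ' _).comp_add_const τ _, ?_⟩)
      (fun τ => ⟨hγ τ, ?_⟩) (by simpa using h)
    · simpa using hb' _
    · simpa using hb _
  rw [← heq]
  exact ((Equiv.addRight (t' - t)).surjective.range_comp γ').symm

end Isolation

/-! ### The oval as a limit cycle -/

/-- A periodic curve that is tangent to a vector field with the right orientation becomes a
periodic solution after a change of time `dτ = dθ / h`. -/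
theorem exists_periodic_solution_of_reparametrization {E : Type*} [NormedAddCommGroup E]
    [NormedSpace ℝ E] {v : E → E} {c : ℝ → E} {h : ℝ → ℝ} {p : ℝ} (hp : 0 < p)
    (hc : ∀ θ, HasDerivAt c ((h θ)⁻¹ • v (c θ)) θ) (hcper : Function.Periodic c p)
    (hh : Continuous h) (hpos : ∀ θ, 0 < h θ) (hhper : Function.Periodic h p) :
    ∃ (γ : ℝ → E) (T : ℝ), (∀ τ, HasDerivAt γ (v (γ τ)) τ) ∧ 0 < T ∧ Function.Periodic γ T ∧
      Set.range γ = Set.range c ∧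
      ∀ κ : E → ℝ, Continuous κ → ∫ τ in 0..T, κ (γ τ) = ∫ θ in 0..p, κ (c θ) / h θ := by
  have hinv : Continuous fun θ => (h θ)⁻¹ := hh.inv₀ fun θ => (hpos θ).ne'
  set t : ℝ → ℝ := fun θ => ∫ φ in 0..θ, (h φ)⁻¹ with ht
  have hder : ∀ θ, HasDerivAt t (h θ)⁻¹ θ := fun θ =>
    intervalIntegral.integral_hasDerivAt_right (hinv.intervalIntegrable _ _)
      (hinv.stronglyMeasurableAtFilter _ _) hinv.continuousAt
  have ht0 : t 0 = 0 := by simp [ht]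
  have htc : Continuous t := continuous_iff_continuousAt.2 fun θ => (hder θ).continuousAt
  have hmono : StrictMono t := strictMono_of_deriv_pos fun θ => by
    rw [(hder θ).deriv]
    exact inv_pos.2 (hpos θ)
  have htadd : ∀ θ, t (θ + p) = t θ + t p := by
    intro θ
    have hinvper : Function.Periodic (fun θ => (h θ)⁻¹) p := hhper.comp fun x => x⁻¹
    have h1 := hinvper.intervalIntegral_add_eq θ 0
    have h2 := intervalIntegral.integral_add_adjacent_intervals
      (hinv.intervalIntegrable (μ := MeasureTheory.volume) 0 θ) (hinv.intervalIntegrable θ (θ + p))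
    rw [h1, zero_add] at h2
    exact h2.symm
  -- `h` is bounded, so the new time runs over the whole line
  obtain ⟨M, hM⟩ : ∃ M, ∀ θ, h θ ≤ M := by
    obtain ⟨M, hM⟩ := (hhper.isBounded_of_continuous hp.ne' hh).exists_norm_le
    exact ⟨M, fun θ => (le_abs_self _).trans (hM _ ⟨θ, rfl⟩)⟩
  have hMpos : 0 < M := (hpos 0).trans_le (hM 0)
  have hdiff : Monotone fun θ => t θ - M⁻¹ * θ := by
    have hd : ∀ θ, HasDerivAt (fun θ => t θ - M⁻¹ * θ) ((h θ)⁻¹ - M⁻¹ * 1) θ := fun θ =>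
      (hder θ).sub ((hasDerivAt_id θ).const_mul _)
    refine monotone_of_deriv_nonneg (fun θ => (hd θ).differentiableAt) fun θ => ?_
    rw [(hd θ).deriv, mul_one, sub_nonneg]
    exact inv_anti₀ (hpos θ) (hM θ)
  have hsurj : Function.Surjective t := by
    refine htc.surjective ?_ ?_
    · refine tendsto_atTop_mono' _ ?_ (tendsto_id.const_mul_atTop (inv_pos.2 hMpos))
      filter_upwards [eventually_ge_atTop 0] with θ hθ
      have := hdiff hθ
      simp only [ht0, mul_zero, sub_zero, id] at this ⊢
      linarith
    · refine tendsto_atBot_mono' _ ?_ (tendsto_id.const_mul_atBot (inv_pos.2 hMpos))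
      filter_upwards [eventually_le_atBot 0] with θ hθ
      have := hdiff hθ
      simp only [ht0, mul_zero, sub_zero, id] at this ⊢
      linarith
  set e := hmono.orderIsoOfSurjective t hsurj with he
  have hte : ∀ τ, t (e.symm τ) = τ := fun τ => e.apply_symm_apply τ
  have het : ∀ θ, e.symm (t θ) = θ := fun θ => e.symm_apply_apply θ
  have hesymm : ∀ τ, HasDerivAt e.symm (h (e.symm τ)) τ := fun τ => by
    have := HasDerivAt.of_local_left_inverse e.symm.continuous.continuousAt (hder (e.symm τ))
      (inv_pos.2 (hpos _)).ne' (Eventually.of_forall hte)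
    rwa [inv_inv] at this
  refine ⟨fun τ => c (e.symm τ), t p, fun τ => ?_, ?_, ?_, ?_, ?_⟩
  · refine ((hc _).scomp τ (hesymm τ)).congr_deriv ?_
    rw [smul_smul, mul_inv_cancel₀ (hpos _).ne', one_smul]
  · rw [← ht0]
    exact hmono hp
  · intro τ
    have : e.symm (τ + t p) = e.symm τ + p := by
      apply hmono.injective
      rw [hte, htadd, hte]
    simp only [this]
    exact hcper _
  · exact e.symm.surjective.range_comp c
  · intro κ hκ
    have hcc : Continuous c := continuous_iff_continuousAt.2 fun θ => (hc θ).continuousAt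
    have hsub := intervalIntegral.integral_comp_mul_deriv (a := 0) (b := p)
      (g := fun τ => κ (c (e.symm τ))) (fun θ _ => hder θ) hinv.continuousOn
      (hκ.comp (hcc.comp e.symm.continuous))
    rw [ht0] at hsub
    rw [← hsub]
    refine intervalIntegral.integral_congr fun θ _ => ?_
    simp only [Function.comp_apply, het]
    rw [div_eq_mul_inv]

/-- The polynomial `(x - s₁)(s₂ - x)`, positive exactly inside the strip. -/
noncomputable def stripPoly (s₁ s₂ : ℝ) : ℝ[X] := (X - C s₁) * (C s₂ - X)

/-- The conditions on the cofactors `p`, `q` of `P = A p` and `Q = A q`, with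
`A = (x - s₁)(s₂ - x)`, which make the strip part of `(y + P)² = Q` a smooth oval that is
crossed by the `x`-axis only at its two extreme points. -/
structure IsOval (P Q p q : ℝ[X]) (s₁ s₂ : ℝ) : Prop where
  lt : s₁ < s₂
  P_eq : P = stripPoly s₁ s₂ * p
  Q_eq : Q = stripPoly s₁ s₂ * q
  q_pos : ∀ x ∈ Set.Icc s₁ s₂, 0 < q.eval x
  lt_q : ∀ x ∈ Set.Icc s₁ s₂, (stripPoly s₁ s₂).eval x * p.eval x ^ 2 < q.eval x

/-- The abscissa `(s₁ + s₂) / 2 - (s₂ - s₁) / 2 · cos θ` of the oval at angle `θ`. -/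
noncomputable def ovalX (s₁ s₂ θ : ℝ) : ℝ := (s₁ + s₂) / 2 - (s₂ - s₁) / 2 * Real.cos θ

/-- The derivative of the abscissa; a signed square root of `(x - s₁)(s₂ - x)`. -/
noncomputable def ovalW (s₁ s₂ θ : ℝ) : ℝ := (s₂ - s₁) / 2 * Real.sin θ

/-- The angular speed `√q - w p` with which the flow runs through the oval. -/
noncomputable def ovalSpeed (p q : ℝ[X]) (s₁ s₂ θ : ℝ) : ℝ :=
  √(q.eval (ovalX s₁ s₂ θ)) - ovalW s₁ s₂ θ * p.eval (ovalX s₁ s₂ θ)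

/-- The parametrization of the oval by an angle. Replacing `√Q` by the smooth function `w √q`
covers both branches `y = -P ± √Q` at once. -/
noncomputable def ovalPoint (p q : ℝ[X]) (s₁ s₂ θ : ℝ) : ℝ × ℝ :=
  (ovalX s₁ s₂ θ, ovalW s₁ s₂ θ * ovalSpeed p q s₁ s₂ θ)

lemma eval_stripPoly (s₁ s₂ x : ℝ) : (stripPoly s₁ s₂).eval x = (x - s₁) * (s₂ - x) := by
  simp [stripPoly]

lemma eval_stripPoly_ovalX (s₁ s₂ θ : ℝ) :
    (stripPoly s₁ s₂).eval (ovalX s₁ s₂ θ) = ovalW s₁ s₂ θ ^ 2 := by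
  rw [eval_stripPoly, ovalX, ovalW]
  linear_combination -((s₂ - s₁) / 2) ^ 2 * Real.sin_sq_add_cos_sq θ

lemma eval_derivative_stripPoly_ovalX (s₁ s₂ θ : ℝ) :
    (stripPoly s₁ s₂).derivative.eval (ovalX s₁ s₂ θ) = (s₂ - s₁) * Real.cos θ := by
  simp only [stripPoly, derivative_mul, derivative_sub, derivative_X, derivative_C, eval_add,
    eval_mul, eval_sub, eval_X, eval_C, eval_one, eval_zero, ovalX]
  ring

lemma ovalX_mem_Icc {s₁ s₂ : ℝ} (h : s₁ < s₂) (θ : ℝ) : ovalX s₁ s₂ θ ∈ Set.Icc s₁ s₂ := by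
  have h1 := Real.neg_one_le_cos θ
  have h2 := Real.cos_le_one θ
  constructor <;> unfold ovalX <;> nlinarith

lemma exists_ovalX_eq {s₁ s₂ x : ℝ} (h : s₁ < s₂) (hx : x ∈ Set.Icc s₁ s₂) :
    ∃ φ ∈ Set.Icc 0 Real.pi, ovalX s₁ s₂ φ = x := by
  have hr : 0 < (s₂ - s₁) / 2 := by linarith
  refine ⟨Real.arccos (((s₁ + s₂) / 2 - x) / ((s₂ - s₁) / 2)),
    ⟨Real.arccos_nonneg _, Real.arccos_le_pi _⟩, ?_⟩
  rw [ovalX, Real.cos_arccos, mul_div_cancel₀ _ hr.ne']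
  · ring
  · rw [le_div_iff₀ hr]
    linarith [hx.2]
  · rw [div_le_iff₀ hr]
    linarith [hx.1]

lemma hasDerivAt_ovalX (s₁ s₂ θ : ℝ) : HasDerivAt (ovalX s₁ s₂) (ovalW s₁ s₂ θ) θ := by
  refine (((Real.hasDerivAt_cos θ).const_mul ((s₂ - s₁) / 2)).const_sub
    ((s₁ + s₂) / 2)).congr_deriv ?_
  rw [ovalW]
  ring

lemma hasDerivAt_eval_ovalX (k : ℝ[X]) (s₁ s₂ θ : ℝ) :
    HasDerivAt (fun t => k.eval (ovalX s₁ s₂ t))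
      (k.derivative.eval (ovalX s₁ s₂ θ) * ovalW s₁ s₂ θ) θ :=
  (k.hasDerivAt (ovalX s₁ s₂ θ)).comp θ (hasDerivAt_ovalX s₁ s₂ θ)

lemma continuous_ovalX (s₁ s₂ : ℝ) : Continuous (ovalX s₁ s₂) := by
  unfold ovalX
  fun_prop

lemma continuous_ovalW (s₁ s₂ : ℝ) : Continuous (ovalW s₁ s₂) := by
  unfold ovalW
  fun_prop

lemma continuous_ovalSpeed (p q : ℝ[X]) (s₁ s₂ : ℝ) : Continuous (ovalSpeed p q s₁ s₂) := by
  unfold ovalSpeed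
  have := continuous_ovalX s₁ s₂
  have := continuous_ovalW s₁ s₂
  fun_prop

lemma ovalX_periodic (s₁ s₂ : ℝ) : Function.Periodic (ovalX s₁ s₂) (2 * Real.pi) := fun θ => by
  simp [ovalX]

lemma ovalW_periodic (s₁ s₂ : ℝ) : Function.Periodic (ovalW s₁ s₂) (2 * Real.pi) := fun θ => by
  simp [ovalW]

lemma ovalSpeed_periodic (p q : ℝ[X]) (s₁ s₂ : ℝ) :
    Function.Periodic (ovalSpeed p q s₁ s₂) (2 * Real.pi) := fun θ => by
  simp only [ovalSpeed, ovalX_periodic s₁ s₂ θ, ovalW_periodic s₁ s₂ θ]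

lemma ovalPoint_periodic (p q : ℝ[X]) (s₁ s₂ : ℝ) :
    Function.Periodic (ovalPoint p q s₁ s₂) (2 * Real.pi) := fun θ => by
  simp only [ovalPoint, ovalX_periodic s₁ s₂ θ, ovalW_periodic s₁ s₂ θ,
    ovalSpeed_periodic p q s₁ s₂ θ]

lemma locallyLipschitz_vectorField (f g : ℝ[X]) : LocallyLipschitz (vectorField f g) := by
  have hf : ContDiff ℝ 1 fun x : ℝ => f.eval x := f.contDiff_aeval 1
  have hg : ContDiff ℝ 1 fun x : ℝ => g.eval x := g.contDiff_aeval 1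
  have : ContDiff ℝ 1 (vectorField f g) := by
    unfold vectorField
    fun_prop
  exact this.locallyLipschitz

lemma locallyLipschitz_eval_fst (k : ℝ[X]) : LocallyLipschitz fun z : ℝ × ℝ => k.eval z.1 := by
  have hk : ContDiff ℝ 1 fun x : ℝ => k.eval x := k.contDiff_aeval 1
  have : ContDiff ℝ 1 fun z : ℝ × ℝ => k.eval z.1 := by fun_prop
  exact this.locallyLipschitz

/-- The curve polynomial is multiplied by the cofactor `2 P' - 2 f` along trajectories. -/
lemma Relations.hasDerivAt_curve {f g P Q : ℝ[X]} (h : Relations f g P Q) {γ : ℝ → ℝ × ℝ}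
    (hγ : ∀ τ, HasDerivAt γ (vectorField f g (γ τ)) τ) (τ : ℝ) :
    HasDerivAt (fun t => ((γ t).2 + P.eval (γ t).1) ^ 2 - Q.eval (γ t).1)
      ((2 * P.derivative - 2 * f).eval (γ τ).1 *
        (((γ τ).2 + P.eval (γ τ).1) ^ 2 - Q.eval (γ τ).1)) τ := by
  have hx : HasDerivAt (fun t => (γ t).1) (γ τ).2 τ :=
    (ContinuousLinearMap.fst ℝ ℝ ℝ).hasFDerivAt.comp_hasDerivAt τ (hγ τ)
  have hy : HasDerivAt (fun t => (γ t).2) (-(f.eval (γ τ).1) * (γ τ).2 - g.eval (γ τ).1) τ :=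
    (ContinuousLinearMap.snd ℝ ℝ ℝ).hasFDerivAt.comp_hasDerivAt τ (hγ τ)
  have hP := (P.hasDerivAt (γ τ).1).comp τ hx
  have hQ := (Q.hasDerivAt (γ τ).1).comp τ hx
  refine (((hy.add hP).pow 2).sub hQ).congr_deriv ?_
  have h1 := congrArg (eval (γ τ).1) h.two_mul_g
  have h2 := congrArg (eval (γ τ).1) h.2.1
  simp only [eval_sub, eval_add, eval_mul, eval_ofNat, Pi.add_apply, Function.comp_apply,
    Nat.cast_ofNat, Nat.add_one_sub_one, pow_one] at h1 h2 ⊢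
  linear_combination (-(γ τ).2 - P.eval (γ τ).1) * h1 - h2

section Oval

variable {f g P Q p q : ℝ[X]} {s₁ s₂ : ℝ}

lemma IsOval.eval_P (h : IsOval P Q p q s₁ s₂) (θ : ℝ) :
    P.eval (ovalX s₁ s₂ θ) = ovalW s₁ s₂ θ ^ 2 * p.eval (ovalX s₁ s₂ θ) := by
  rw [h.P_eq, eval_mul, eval_stripPoly_ovalX]

lemma IsOval.eval_Q (h : IsOval P Q p q s₁ s₂) (θ : ℝ) :
    Q.eval (ovalX s₁ s₂ θ) = ovalW s₁ s₂ θ ^ 2 * q.eval (ovalX s₁ s₂ θ) := by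
  rw [h.Q_eq, eval_mul, eval_stripPoly_ovalX]

lemma IsOval.abs_lt_sqrt (h : IsOval P Q p q s₁ s₂) (θ : ℝ) :
    |ovalW s₁ s₂ θ * p.eval (ovalX s₁ s₂ θ)| < √(q.eval (ovalX s₁ s₂ θ)) := by
  apply Real.lt_sqrt_of_sq_lt
  have := h.lt_q _ (ovalX_mem_Icc h.lt θ)
  rwa [eval_stripPoly_ovalX, ← mul_pow, ← sq_abs] at this

lemma IsOval.speed_pos (h : IsOval P Q p q s₁ s₂) (θ : ℝ) : 0 < ovalSpeed p q s₁ s₂ θ :=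
  sub_pos.2 ((le_abs_self _).trans_lt (h.abs_lt_sqrt θ))

/-- The oval is exactly the part of the curve in the strip. -/
lemma IsOval.range_ovalPoint (h : IsOval P Q p q s₁ s₂) :
    Set.range (ovalPoint p q s₁ s₂) = stripCurve P Q s₁ s₂ := by
  have hlt := h.lt
  ext ⟨x, y⟩
  simp only [Set.mem_range, stripCurve, Set.mem_ofPred_eq, mem_zeroSet_hyperellipticPoly]
  constructor
  · rintro ⟨θ, hθ⟩
    simp only [ovalPoint, Prod.mk.injEq] at hθ
    obtain ⟨rfl, rfl⟩ := hθ
    refine ⟨?_, ovalX_mem_Icc hlt θ⟩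
    rw [h.eval_P, h.eval_Q, ovalSpeed]
    linear_combination ovalW s₁ s₂ θ ^ 2 *
      Real.sq_sqrt (h.q_pos _ (ovalX_mem_Icc hlt θ)).le
  · rintro ⟨hcurve, hx1, hx2⟩
    obtain ⟨φ, -, hX⟩ := exists_ovalX_eq hlt ⟨hx1, hx2⟩
    have hX' : ovalX s₁ s₂ (-φ) = x := by rw [← hX]; simp [ovalX]
    have hW' : ovalW s₁ s₂ (-φ) = -ovalW s₁ s₂ φ := by simp [ovalW]
    have hsq := Real.sq_sqrt (h.q_pos x ⟨hx1, hx2⟩).le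
    have hP := h.eval_P φ
    have hQ := h.eval_Q φ
    rw [hX] at hP hQ
    have hsplit : (y + P.eval x) ^ 2 = (ovalW s₁ s₂ φ * √(q.eval x)) ^ 2 := by
      linear_combination hcurve + hQ - ovalW s₁ s₂ φ ^ 2 * hsq
    rcases sq_eq_sq_iff_eq_or_eq_neg.1 hsplit with hy | hy
    · refine ⟨φ, ?_⟩
      simp only [ovalPoint, ovalSpeed, hX, Prod.mk.injEq, true_and]
      linear_combination -hy + hP
    · refine ⟨-φ, ?_⟩
      simp only [ovalPoint, ovalSpeed, hX', hW', Prod.mk.injEq, true_and]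
      linear_combination -hy + hP

/-- The oval is tangent to the vector field, also at its extreme points, because the relations
between the coefficients survive the division by `(x - s₁)(s₂ - x)`. -/
lemma IsOval.hasDerivAt_ovalPoint (h : IsOval P Q p q s₁ s₂) (hrel : Relations f g P Q) (θ : ℝ) :
    HasDerivAt (ovalPoint p q s₁ s₂)
      ((ovalSpeed p q s₁ s₂ θ)⁻¹ • vectorField f g (ovalPoint p q s₁ s₂ θ)) θ := by
  have hA : stripPoly s₁ s₂ ≠ 0 := fun hA => hrel.1 (by rw [h.Q_eq, hA, zero_mul])
  obtain ⟨-, h1, h2⟩ := hrel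
  -- the relations after division by `A`
  have h1' : 2 * q * f = 2 * q * P.derivative + p * Q.derivative := by
    apply mul_left_cancel₀ hA
    linear_combination h1 - (2 * f - 2 * P.derivative) * h.Q_eq + Q.derivative * h.P_eq
  have h2' : 2 * q * g = Q.derivative * (stripPoly s₁ s₂ * p ^ 2 - q) := by
    apply mul_left_cancel₀ hA
    linear_combination h2 - (2 * g + Q.derivative) * h.Q_eq
      + Q.derivative * (P + stripPoly s₁ s₂ * p) * h.P_eq
  have h3 : Q.derivative = (stripPoly s₁ s₂).derivative * q + stripPoly s₁ s₂ * q.derivative := by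
    rw [h.Q_eq, derivative_mul]
  have h4 : P.derivative = (stripPoly s₁ s₂).derivative * p + stripPoly s₁ s₂ * p.derivative := by
    rw [h.P_eq, derivative_mul]
  set x := ovalX s₁ s₂ θ with hx
  have e1 := congrArg (eval x) h1'
  have e2 := congrArg (eval x) h2'
  have e3 := congrArg (eval x) h3
  have e4 := congrArg (eval x) h4
  simp only [eval_sub, eval_add, eval_mul, eval_pow, eval_ofNat] at e1 e2 e3 e4
  rw [hx, eval_stripPoly_ovalX, ← hx] at e2 e3 e4
  rw [hx, eval_derivative_stripPoly_ovalX, ← hx] at e3 e4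
  have hq := h.q_pos x (ovalX_mem_Icc h.lt θ)
  have hu : 0 < √(q.eval x) := Real.sqrt_pos.2 hq
  have hsq := Real.sq_sqrt hq.le
  have hh := h.speed_pos θ
  have hX := hasDerivAt_ovalX s₁ s₂ θ
  have hW : HasDerivAt (ovalW s₁ s₂) ((s₂ - s₁) / 2 * Real.cos θ) θ :=
    (Real.hasDerivAt_sin θ).const_mul _
  have hqX := (hasDerivAt_eval_ovalX q s₁ s₂ θ).sqrt hq.ne'
  have hpX := hasDerivAt_eval_ovalX p s₁ s₂ θ
  have hspeed := hqX.sub (hW.mul hpX)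
  refine (hX.prodMk (hW.mul hspeed)).congr_deriv ?_
  have hspeed_eq : ovalSpeed p q s₁ s₂ θ = √(q.eval x) - ovalW s₁ s₂ θ * p.eval x := rfl
  simp only [vectorField, ovalPoint, Prod.smul_mk, smul_eq_mul, Prod.mk.injEq, ← hx]
  refine ⟨by field_simp, ?_⟩
  simp only [Pi.sub_apply, Pi.mul_apply, ← hx]
  rw [eq_inv_mul_iff_mul_eq₀ hh.ne', hspeed_eq]
  rw [hspeed_eq] at hh
  generalize √(q.eval x) = u at *
  set w := ovalW s₁ s₂ θ
  set D := q.derivative.eval x * w / (2 * u) with hDdef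
  have hD : 2 * u * D = q.derivative.eval x * w := mul_div_cancel₀ _ (by positivity)
  have hq2 : q.eval x = u ^ 2 := hsq.symm
  rw [hq2] at e1 e2 e3
  apply mul_left_cancel₀ (show (2 * u ^ 2 : ℝ) ≠ 0 by positivity)
  linear_combination w * (u - w * p.eval x) * e1 + e2 + 2 * u ^ 2 * w * (u - w * p.eval x) * e4
    - u * (u - w * p.eval x) * e3 + u * (u - w * p.eval x) * w * hD

/-- If the cofactor has a nonzero integral along the oval, then the oval is a limit cycle. -/
theorem IsOval.isLimitCycle (h : IsOval P Q p q s₁ s₂) (hrel : Relations f g P Q)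
    (hI : ∫ θ in 0..2 * Real.pi,
      (2 * P.derivative - 2 * f).eval (ovalX s₁ s₂ θ) / ovalSpeed p q s₁ s₂ θ ≠ 0) :
    IsLimitCycle f g (stripCurve P Q s₁ s₂) := by
  obtain ⟨γ, T, hγ, hT, hper, hrange, hint⟩ := exists_periodic_solution_of_reparametrization
    Real.two_pi_pos (h.hasDerivAt_ovalPoint hrel) (ovalPoint_periodic p q s₁ s₂)
    (continuous_ovalSpeed p q s₁ s₂) h.speed_pos (ovalSpeed_periodic p q s₁ s₂)
  rw [h.range_ovalPoint] at hrange
  have hκ := locallyLipschitz_eval_fst (2 * P.derivative - 2 * f)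
  have hv := locallyLipschitz_vectorField f g
  have hV : Continuous fun z : ℝ × ℝ => (z.2 + P.eval z.1) ^ 2 - Q.eval z.1 := by fun_prop
  obtain ⟨U, hU, hsub, hzero⟩ := exists_isOpen_forall_periodic_eq_zero hv hκ hV
    (fun γ hγ => hrel.hasDerivAt_curve hγ) hγ hT hper (by rwa [hint _ hκ.continuous])
  refine ⟨⟨γ, hγ, ⟨T, hT, hper⟩, ?_, hrange⟩, U ∩ {z | 0 < q.eval z.1},
    hU.inter (isOpen_lt continuous_const (by fun_prop)), fun z hz =>
      ⟨hsub (hrange ▸ hz), h.q_pos _ hz.2⟩, ?_⟩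
  · have hends : ∀ θ, ∃ τ, γ τ = ovalPoint p q s₁ s₂ θ := fun θ => by
      rw [← Set.mem_range, hrange, ← h.range_ovalPoint]
      exact ⟨θ, rfl⟩
    obtain ⟨τ₁, h₁⟩ := hends 0
    obtain ⟨τ₂, h₂⟩ := hends Real.pi
    refine ⟨τ₁, τ₂, fun heq => h.lt.ne ?_⟩
    rw [h₁, h₂] at heq
    have := congrArg Prod.fst heq
    simp only [ovalPoint, ovalX, Real.cos_zero, Real.cos_pi] at this
    linarith
  · rintro O' ⟨γ', hγ', hper', -, rfl⟩ hO'
    have hmem : ∀ τ, γ' τ ∈ Set.range γ := fun τ => by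
      have hV0 := hzero γ' hγ' hper' (hO'.trans Set.inter_subset_left) τ
      have hq : 0 < q.eval (γ' τ).1 := (hO' ⟨τ, rfl⟩).2
      rw [hrange]
      refine ⟨(mem_zeroSet_hyperellipticPoly P Q _).2 hV0, ?_⟩
      -- outside the strip `Q` is negative wherever `q` is positive
      have hQ0 : 0 ≤ Q.eval (γ' τ).1 := by
        rw [← sub_eq_zero.1 hV0]
        positivity
      rw [h.Q_eq, eval_mul, eval_stripPoly] at hQ0
      have hA := nonneg_of_mul_nonneg_left hQ0 hq
      have hlt := h.lt
      constructor <;> by_contra! hcon <;> nlinarith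
    have hγc : Continuous γ := continuous_iff_continuousAt.2 fun τ => (hγ τ).continuousAt
    obtain ⟨R, hR⟩ := (hper.isBounded_of_continuous hT.ne' hγc).exists_norm_le
    obtain ⟨t, ht⟩ := hmem 0
    rw [← hrange]
    exact range_eq_of_meet hv hγ hγ' (fun τ => hR _ ⟨τ, rfl⟩) (fun τ => hR _ (hmem τ)) ht.symm

end Oval

/-! ### Cauchy type integrals with arbitrarily large zeros -/

section Moments

variable {x φ : ℝ → ℝ} {a b : ℝ}

lemma exists_forall_uIcc_abs_le (hx : Continuous x) (a b : ℝ) :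
    ∃ R, ∀ θ ∈ Set.uIcc a b, |x θ| ≤ R := by
  obtain ⟨R, hR⟩ := (isCompact_uIcc (a := a) (b := b)).exists_bound_of_continuousOn hx.continuousOn
  exact ⟨R, hR⟩

lemma tendsto_integral_div_sub_atTop (hx : Continuous x) (hφ : Continuous φ) :
    Tendsto (fun s => ∫ θ in a..b, φ θ / (s - x θ)) atTop (𝓝 0) := by
  obtain ⟨R, hR⟩ := exists_forall_uIcc_abs_le hx a b
  obtain ⟨M, hM⟩ := exists_forall_uIcc_abs_le hφ a b
  have hlim : Tendsto (fun s : ℝ => M / (s - R) * |b - a|) atTop (𝓝 0) := by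
    have h1 : Tendsto (fun s : ℝ => s - R) atTop atTop := tendsto_atTop_add_const_right _ _ tendsto_id
    simpa using (h1.const_div_atTop M).mul_const |b - a|
  refine squeeze_zero_norm' ?_ hlim
  filter_upwards [eventually_gt_atTop R] with s hs
  refine intervalIntegral.norm_integral_le_of_norm_le_const fun θ hθ => ?_
  have hθ' := Set.uIoc_subset_uIcc hθ
  have h1 := hM θ hθ'
  have h2 := (le_abs_self _).trans (hR θ hθ')
  rw [Real.norm_eq_abs, abs_div, abs_of_pos (show 0 < s - x θ by linarith)]
  have hRs : 0 < s - R := by linarith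
  have hM0 : 0 ≤ M := (abs_nonneg _).trans h1
  gcongr

lemma eq_zero_of_frequently_add_integral_eq_zero (hx : Continuous x) (hφ : Continuous φ) {c : ℝ}
    (h : ∃ᶠ s in atTop, c + ∫ θ in a..b, φ θ / (s - x θ) = 0) : c = 0 := by
  by_contra hc
  have hlim : Tendsto (fun s => c + ∫ θ in a..b, φ θ / (s - x θ)) atTop (𝓝 c) := by
    simpa using (tendsto_integral_div_sub_atTop (a := a) (b := b) hx hφ).const_add c
  exact h (hlim.eventually_ne hc)

/-- The expansion `φ / (s - x) = s⁻¹ (φ + x φ / (s - x))` at infinity, integrated. -/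
lemma eventually_mul_integral_div_sub (hx : Continuous x) (hφ : Continuous φ) :
    ∀ᶠ s in atTop, s * ∫ θ in a..b, φ θ / (s - x θ) =
      (∫ θ in a..b, φ θ) + ∫ θ in a..b, x θ * φ θ / (s - x θ) := by
  obtain ⟨R, hR⟩ := exists_forall_uIcc_abs_le hx a b
  filter_upwards [eventually_gt_atTop R] with s hs
  have hne : ∀ θ ∈ Set.uIcc a b, s - x θ ≠ 0 := fun θ hθ => by
    have := (le_abs_self _).trans (hR θ hθ)
    linarith
  have hint : IntervalIntegrable (fun θ => x θ * φ θ / (s - x θ)) MeasureTheory.volume a b :=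
    ((hx.mul hφ).continuousOn.div (by fun_prop) hne).intervalIntegrable
  rw [← intervalIntegral.integral_const_mul,
    ← intervalIntegral.integral_add (hφ.intervalIntegrable _ _) hint]
  refine intervalIntegral.integral_congr fun θ hθ => ?_
  have := hne θ hθ
  field_simp
  ring

/-- If the Cauchy type integral `c + ∫ φ / (s - x)` vanishes for arbitrarily large `s`, then
all its expansion coefficients at infinity vanish. -/
lemma moments_eq_zero (hx : Continuous x) (j : ℕ) : ∀ {φ : ℝ → ℝ} {c : ℝ}, Continuous φ →
    (∃ᶠ s in atTop, c + ∫ θ in a..b, φ θ / (s - x θ) = 0) → ∫ θ in a..b, x θ ^ j * φ θ = 0 := by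
  -- the next coefficient takes over the role of the constant
  have step : ∀ {φ : ℝ → ℝ} {c : ℝ}, Continuous φ →
      (∃ᶠ s in atTop, c + ∫ θ in a..b, φ θ / (s - x θ) = 0) →
      ∃ᶠ s in atTop, (∫ θ in a..b, φ θ) + ∫ θ in a..b, x θ * φ θ / (s - x θ) = 0 := by
    intro φ c hφ h
    obtain rfl := eq_zero_of_frequently_add_integral_eq_zero hx hφ h
    refine (h.and_eventually (eventually_mul_integral_div_sub (a := a) (b := b) hx hφ)).mono ?_
    rintro s ⟨h1, h2⟩
    rw [← h2, show ∫ θ in a..b, φ θ / (s - x θ) = 0 by linarith, mul_zero]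
  induction j with
  | zero =>
    intro φ c hφ h
    simpa using eq_zero_of_frequently_add_integral_eq_zero hx (hx.mul hφ) (step hφ h)
  | succ j ih =>
    intro φ c hφ h
    rw [← ih (hx.mul hφ) (step hφ h)]
    exact intervalIntegral.integral_congr fun θ _ => by
      simp only [Pi.mul_apply]
      ring

lemma integral_eval_mul_eq_zero (hx : Continuous x) (hφ : Continuous φ) {c : ℝ}
    (h : ∃ᶠ s in atTop, c + ∫ θ in a..b, φ θ / (s - x θ) = 0) (p : ℝ[X]) :
    ∫ θ in a..b, p.eval (x θ) * φ θ = 0 := by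
  induction p using Polynomial.induction_on' with
  | add p q hp hq =>
    have hi : ∀ r : ℝ[X], IntervalIntegrable (fun θ => r.eval (x θ) * φ θ)
        MeasureTheory.volume a b := fun r =>
      Continuous.intervalIntegrable (by fun_prop) _ _
    simp only [eval_add, add_mul]
    rw [intervalIntegral.integral_add (hi p) (hi q), hp, hq, add_zero]
  | monomial n r =>
    simp only [eval_monomial, mul_assoc]
    rw [intervalIntegral.integral_const_mul, moments_eq_zero hx n hφ h, mul_zero]

end Moments

/-! ### Ovals of the system with the additional double root -/

section LargeShift

variable {f g P Q p q : ℝ[X]} {s₁ s₂ : ℝ}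

/-- That `P` vanishes at the simple roots `s₁`, `s₂` of `Q` follows from `2 Q f = 2 Q P' + P Q'`. -/
lemma SufficientConditions.exists_isOval (h : SufficientConditions f g P Q s₁ s₂) :
    ∃ p q : ℝ[X], IsOval P Q p q s₁ s₂ := by
  have hlt := h.lt
  obtain ⟨hQ0, hrel, -⟩ := h.relations
  have hcop : IsCoprime (X - C s₁ : ℝ[X]) (C s₂ - X) := by
    have := (isCoprime_X_sub_C_of_isUnit_sub
      (show IsUnit (s₁ - s₂) from (sub_ne_zero.2 hlt.ne).isUnit)).neg_right
    rwa [neg_sub] at this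
  have hdvd : ∀ {R : ℝ[X]}, R.IsRoot s₁ → R.IsRoot s₂ → stripPoly s₁ s₂ ∣ R := fun h₁ h₂ => by
    refine hcop.mul_dvd (dvd_iff_isRoot.2 h₁) ?_
    rw [← neg_dvd, neg_sub]
    exact dvd_iff_isRoot.2 h₂
  have hroot : ∀ {s : ℝ}, Q.rootMultiplicity s = 1 → Q.IsRoot s := fun hs =>
    (rootMultiplicity_pos hQ0).1 (by omega)
  obtain ⟨q, hq⟩ := hdvd (hroot h.simple_left) (hroot h.simple_right)
  have hq0 : q ≠ 0 := fun h0 => hQ0 (by rw [hq, h0, mul_zero])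
  have hA0 : stripPoly s₁ s₂ ≠ 0 := fun h0 => hQ0 (by rw [hq, h0, zero_mul])
  have hsimple : ∀ {s : ℝ}, Q.rootMultiplicity s = 1 → (stripPoly s₁ s₂).IsRoot s →
      q.eval s ≠ 0 := by
    intro s hs hA hqs
    rw [hq, rootMultiplicity_mul (hq ▸ hQ0)] at hs
    have h1 := (rootMultiplicity_pos hA0).2 hA
    have h2 := (rootMultiplicity_pos hq0).2 hqs
    omega
  have hA₁ : (stripPoly s₁ s₂).IsRoot s₁ := by simp [IsRoot, eval_stripPoly]
  have hA₂ : (stripPoly s₁ s₂).IsRoot s₂ := by simp [IsRoot, eval_stripPoly]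
  have hq₁ := hsimple h.simple_left hA₁
  have hq₂ := hsimple h.simple_right hA₂
  have hQ' : ∀ {s : ℝ}, (stripPoly s₁ s₂).IsRoot s → q.eval s ≠ 0 → s₁ + s₂ - 2 * s ≠ 0 →
      P.IsRoot s := by
    intro s hA hqs hs
    have hA' : (stripPoly s₁ s₂).derivative.eval s = s₁ + s₂ - 2 * s := by
      simp only [stripPoly, derivative_mul, derivative_sub, derivative_X, derivative_C, eval_add,
        eval_mul, eval_sub, eval_X, eval_C, eval_one, eval_zero]
      ring
    have h1 := congrArg (eval s) hrel
    rw [hq, derivative_mul] at h1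
    simp only [eval_add, eval_mul, eval_ofNat, hA.eq_zero, hA'] at h1
    have h2 : P.eval s * ((s₁ + s₂ - 2 * s) * q.eval s) = 0 := by linear_combination -h1
    exact (mul_eq_zero.1 h2).resolve_right (mul_ne_zero hs hqs)
  obtain ⟨p, hp⟩ := hdvd (R := P) (hQ' hA₁ hq₁ (by linarith [hlt] : s₁ + s₂ - 2 * s₁ ≠ 0))
    (hQ' hA₂ hq₂ (by linarith [hlt] : s₁ + s₂ - 2 * s₂ ≠ 0))
  have hApos : ∀ x ∈ Set.Ioo s₁ s₂, 0 < (stripPoly s₁ s₂).eval x := fun x hx => by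
    rw [eval_stripPoly]
    exact mul_pos (sub_pos.2 hx.1) (sub_pos.2 hx.2)
  have hqIoo : ∀ x ∈ Set.Ioo s₁ s₂, 0 < q.eval x := fun x hx => by
    have := h.Q_pos x hx
    rw [hq, eval_mul] at this
    exact pos_of_mul_pos_right this (hApos x hx).le
  have hqIcc : ∀ x ∈ Set.Icc s₁ s₂, 0 ≤ q.eval x := fun x hx => by
    rw [← closure_Ioo hlt.ne] at hx
    exact le_on_closure (f := fun _ => (0 : ℝ)) (fun y hy => (hqIoo y hy).le) (by fun_prop)
      q.continuous.continuousOn hx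
  have hqpos : ∀ x ∈ Set.Icc s₁ s₂, 0 < q.eval x := fun x hx => by
    rcases Set.eq_endpoints_or_mem_Ioo_of_mem_Icc hx with rfl | rfl | hx'
    · exact (hqIcc _ hx).lt_of_ne' hq₁
    · exact (hqIcc _ hx).lt_of_ne' hq₂
    · exact hqIoo x hx'
  refine ⟨p, q, hlt, hp, hq, hqpos, fun x hx => ?_⟩
  rcases Set.eq_endpoints_or_mem_Ioo_of_mem_Icc hx with rfl | rfl | hx'
  · rw [hA₁.eq_zero, zero_mul]
    exact hqpos _ hx
  · rw [hA₂.eq_zero, zero_mul]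
    exact hqpos _ hx
  · have h1 := h.neg x hx'
    rw [hp, hq, eval_sub, eval_pow, eval_mul, eval_mul] at h1
    have h2 := hApos x hx'
    nlinarith

lemma IsOval.neg (h : IsOval P Q p q s₁ s₂) : IsOval (-P) Q (-p) q s₁ s₂ :=
  ⟨h.lt, by rw [h.P_eq, mul_neg], h.Q_eq, h.q_pos, fun x hx => by simpa using h.lt_q x hx⟩

lemma IsOval.mul_linear (h : IsOval P Q p q s₁ s₂) {s : ℝ} (hs : s₂ < s) :
    IsOval (P * (X - C s)) (Q * (X - C s) ^ 2) (p * (X - C s)) (q * (X - C s) ^ 2) s₁ s₂ := by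
  have hpos : ∀ x ∈ Set.Icc s₁ s₂, 0 < (x - s) ^ 2 := fun x hx => by
    have : x - s ≠ 0 := by linarith [hx.2]
    positivity
  refine ⟨h.lt, by rw [h.P_eq]; ring, by rw [h.Q_eq]; ring, fun x hx => ?_, fun x hx => ?_⟩
  · simpa using mul_pos (h.q_pos x hx) (hpos x hx)
  · have := mul_lt_mul_of_pos_right (h.lt_q x hx) (hpos x hx)
    simpa [mul_pow, mul_assoc] using this

/-- As `x - s` is negative on the strip, the new speed is the speed for `-P`, up to
the factor `s - x`. -/
lemma IsOval.speed_mul_linear (h : IsOval P Q p q s₁ s₂) {s : ℝ} (hs : s₂ < s) (θ : ℝ) :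
    ovalSpeed (p * (X - C s)) (q * (X - C s) ^ 2) s₁ s₂ θ =
      (s - ovalX s₁ s₂ θ) * ovalSpeed (-p) q s₁ s₂ θ := by
  have hx := ovalX_mem_Icc h.lt θ
  have hle : 0 ≤ s - ovalX s₁ s₂ θ := by linarith [hx.2]
  simp only [ovalSpeed, eval_mul, eval_pow, eval_sub, eval_X, eval_C, eval_neg]
  rw [Real.sqrt_mul (h.q_pos _ hx).le, ← neg_sub s, neg_sq, Real.sqrt_sq hle]
  ring

lemma IsOval.image_fst_stripCurve (h : IsOval P Q p q s₁ s₂) :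
    Prod.fst '' stripCurve P Q s₁ s₂ = Set.Icc s₁ s₂ := by
  rw [← h.range_ovalPoint, ← Set.range_comp]
  ext x
  constructor
  · rintro ⟨θ, rfl⟩
    exact ovalX_mem_Icc h.lt θ
  · intro hx
    obtain ⟨θ, -, hθ⟩ := exists_ovalX_eq h.lt hx
    exact ⟨θ, hθ⟩

/-- The integral of the cofactor along the oval of the new system is, up to a constant factor,
a Cauchy type integral with density `P / (√q + w p)`. If it had arbitrarily large zeros,
the density would be orthogonal to all polynomials in `x`, in particular to `P`. -/
lemma IsOval.eventually_integral_ne_zero (h : IsOval P Q p q s₁ s₂) (hP : P ≠ 0) (f : ℝ[X]) :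
    ∀ᶠ s in atTop, ∫ θ in 0..2 * Real.pi,
      (2 * (P * (X - C s)).derivative - 2 * ((X - C s) * f + 2 * P) : ℝ[X]).eval (ovalX s₁ s₂ θ) /
        ovalSpeed (p * (X - C s)) (q * (X - C s) ^ 2) s₁ s₂ θ ≠ 0 := by
  set σ := ovalSpeed (-p) q s₁ s₂ with hσ
  have hσpos : ∀ θ, 0 < σ θ := h.neg.speed_pos
  have hσc : Continuous σ := continuous_ovalSpeed _ _ _ _
  have hxc := continuous_ovalX s₁ s₂
  have hφ : Continuous fun θ => P.eval (ovalX s₁ s₂ θ) / σ θ :=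
    Continuous.div (by fun_prop) hσc fun θ => (hσpos θ).ne'
  have hk : Continuous fun θ => (2 * P.derivative - 2 * f).eval (ovalX s₁ s₂ θ) / σ θ :=
    Continuous.div (by fun_prop) hσc fun θ => (hσpos θ).ne'
  by_contra hcon
  have hfreq : ∃ᶠ s in atTop,
      (∫ θ in 0..2 * Real.pi, (2 * P.derivative - 2 * f).eval (ovalX s₁ s₂ θ) / σ θ) / 2 +
        ∫ θ in 0..2 * Real.pi, P.eval (ovalX s₁ s₂ θ) / σ θ / (s - ovalX s₁ s₂ θ) = 0 := by
    refine ((not_eventually.1 hcon).and_eventually (eventually_gt_atTop s₂)).mono ?_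
    rintro s ⟨h0, hs⟩
    have hne : ∀ θ, s - ovalX s₁ s₂ θ ≠ 0 := fun θ => by
      have := (ovalX_mem_Icc h.lt θ).2
      linarith
    have hφs : Continuous fun θ => P.eval (ovalX s₁ s₂ θ) / σ θ / (s - ovalX s₁ s₂ θ) :=
      hφ.div (by fun_prop) hne
    have hsplit : ∀ θ,
        (2 * (P * (X - C s)).derivative - 2 * ((X - C s) * f + 2 * P) : ℝ[X]).eval (ovalX s₁ s₂ θ) /
          ovalSpeed (p * (X - C s)) (q * (X - C s) ^ 2) s₁ s₂ θ =
        -((2 * P.derivative - 2 * f).eval (ovalX s₁ s₂ θ) / σ θ) -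
          2 * (P.eval (ovalX s₁ s₂ θ) / σ θ / (s - ovalX s₁ s₂ θ)) := by
      intro θ
      have h1 := hne θ
      have h2 := (hσpos θ).ne'
      rw [h.speed_mul_linear hs, ← hσ]
      simp only [derivative_mul, derivative_sub, derivative_X, derivative_C, eval_sub, eval_mul,
        eval_add, eval_X, eval_C, eval_one, eval_zero, eval_ofNat]
      field_simp
      ring
    rw [not_not] at h0
    simp only [hsplit] at h0
    have hk' : Continuous fun θ => -((2 * P.derivative - 2 * f).eval (ovalX s₁ s₂ θ) / σ θ) := hk.neg
    rw [intervalIntegral.integral_sub (hk'.intervalIntegrable _ _)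
      ((hφs.const_mul 2).intervalIntegrable _ _), intervalIntegral.integral_neg,
      intervalIntegral.integral_const_mul] at h0
    linarith
  have hzero := integral_eval_mul_eq_zero hxc hφ hfreq P
  obtain ⟨x, hx, hPx⟩ : ∃ x ∈ Set.Icc s₁ s₂, P.eval x ≠ 0 := by
    by_contra! hall
    exact hP (eq_zero_of_infinite_isRoot P ((Set.Icc_infinite h.lt).mono hall))
  obtain ⟨θ, hθ, rfl⟩ := exists_ovalX_eq h.lt hx
  have hint : Continuous fun θ => P.eval (ovalX s₁ s₂ θ) * (P.eval (ovalX s₁ s₂ θ) / σ θ) := by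
    fun_prop
  refine (intervalIntegral.integral_pos Real.two_pi_pos
    hint.continuousOn (fun θ _ => ?_) ⟨θ, ?_, ?_⟩).ne' hzero
  · have := hσpos θ
    rw [← mul_div_assoc]
    exact div_nonneg (mul_self_nonneg _) this.le
  · exact ⟨hθ.1, by linarith [hθ.2, Real.pi_pos]⟩
  · rw [← mul_div_assoc]
    exact div_pos (mul_self_pos.2 hPx) (hσpos θ)

end LargeShift

/-! ### Translation along the `x`-axis -/

section Translation

variable {f g P Q : ℝ[X]} {O : Set (ℝ × ℝ)}

lemma IsClosedOrbit.translate (h : IsClosedOrbit f g O) (c : ℝ) :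
    IsClosedOrbit (f.comp (X + C c)) (g.comp (X + C c)) ((· - (c, 0)) '' O) := by
  obtain ⟨γ, hγ, ⟨T, hT, hper⟩, ⟨τ₁, τ₂, hne⟩, rfl⟩ := h
  refine ⟨fun τ => γ τ - (c, 0), fun τ => ?_, ⟨T, hT, fun τ => by simp only [hper τ]⟩,
    ⟨τ₁, τ₂, fun h => hne (sub_left_injective h)⟩, Set.range_comp (· - ((c, 0) : ℝ × ℝ)) γ⟩
  refine ((hγ τ).sub_const (c, 0)).congr_deriv ?_
  simp [vectorField]

lemma comp_X_add_C_comp_neg (f : ℝ[X]) (c : ℝ) : (f.comp (X + C c)).comp (X + C (-c)) = f := by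
  simp [comp_assoc]

lemma IsLimitCycle.translate (h : IsLimitCycle f g O) (c : ℝ) :
    IsLimitCycle (f.comp (X + C c)) (g.comp (X + C c)) ((· - (c, 0)) '' O) := by
  obtain ⟨hO, U, hU, hOU, hiso⟩ := h
  refine ⟨hO.translate c, (· + (c, 0)) ⁻¹' U, hU.preimage (by fun_prop), ?_, fun O' hO' hsub => ?_⟩
  · rintro _ ⟨z, hz, rfl⟩
    simpa using hOU hz
  · have hback := hO'.translate (-c)
    rw [comp_X_add_C_comp_neg, comp_X_add_C_comp_neg] at hback
    rw [← hiso _ hback]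
    · have hid : ∀ z : ℝ × ℝ, z - (-c, 0) - (c, 0) = z := fun z => by ext <;> simp
      simp only [Set.image_image, hid, Set.image_id']
    · rintro _ ⟨z, hz, rfl⟩
      have hz' : z + (c, 0) ∈ U := hsub hz
      have hshift : z - (-c, 0) = z + (c, 0) := by ext <;> simp
      change z - (-c, 0) ∈ U
      rwa [hshift]

lemma IsHyperellipticLimitCycleOn.translate (hrel : Relations f g P Q)
    (h : IsHyperellipticLimitCycleOn f g P Q O) (c : ℝ) :
    IsHyperellipticLimitCycleOn (f.comp (X + C c)) (g.comp (X + C c)) (P.comp (X + C c))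
      (Q.comp (X + C c)) ((· - (c, 0)) '' O) := by
  refine ⟨h.1.translate c, (hrel.translated c).isInvariantCurve, ?_⟩
  rintro _ ⟨z, hz, rfl⟩
  have := (mem_zeroSet_hyperellipticPoly P Q z).1 (h.2.2 hz)
  rw [mem_zeroSet_hyperellipticPoly]
  simpa using this

end Translation

end Lienard

theorem lemma9 (m n t : ℕ) (f g P Q : Polynomial ℝ)
    (hfg : Lienard.IsSystemOfType m n f g) (hQ : Q ≠ 0)
    (hinv : Lienard.IsInvariantCurve f g (Lienard.hyperellipticPoly P Q))
    (O : Fin t → Set (ℝ × ℝ)) (hO : Function.Injective O)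
    (hcycle : ∀ i, Lienard.IsHyperellipticLimitCycleOn f g P Q (O i))
    (hcond : ∀ i, ∃ s₁ s₂ : ℝ,
      O i = Lienard.stripCurve P Q s₁ s₂ ∧ Lienard.SufficientConditions f g P Q s₁ s₂) :
    (∃ f₁ g₁ : Polynomial ℝ, Lienard.IsSystemOfType (m + 1) (n + 2) f₁ g₁ ∧
      (t : ℕ∞) ≤ {C | Lienard.IsHyperellipticLimitCycle f₁ g₁ C}.encard) ∧
    (∀ᶠ s : ℝ in Filter.atTop, ∃ F G : Polynomial ℝ,
      Lienard.Relations F G (P * (Polynomial.X - Polynomial.C s))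
        (Q * (Polynomial.X - Polynomial.C s) ^ 2) ∧
      F.degree = ((m + 1 : ℕ) : WithBot ℕ) ∧ G.degree = ((n + 2 : ℕ) : WithBot ℕ) ∧
      (t : ℕ∞) ≤ {C | Lienard.IsHyperellipticLimitCycleOn F G
        (P * (Polynomial.X - Polynomial.C s)) (Q * (Polynomial.X - Polynomial.C s) ^ 2) C}.encard ∧
      ∃ c : ℝ, Lienard.IsSystemOfType (m + 1) (n + 2)
        (F.comp (Polynomial.X + Polynomial.C c)) (G.comp (Polynomial.X + Polynomial.C c))) := by
  obtain ⟨hf, hg, -⟩ := hfg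
  have hrel := Lienard.relations_of_isInvariantCurve hQ hinv
  have hP : P ≠ 0 := by
    rintro rfl
    have := (hrel.coeff_f hf).1
    simp at this
  choose s₁ s₂ hOeq hsuff using hcond
  choose p q hoval using fun i => (hsuff i).exists_isOval
  have hlarge : ∀ᶠ s : ℝ in Filter.atTop, ∃ F G : Polynomial ℝ,
      Lienard.Relations F G (P * (Polynomial.X - Polynomial.C s))
        (Q * (Polynomial.X - Polynomial.C s) ^ 2) ∧
      F.degree = ((m + 1 : ℕ) : WithBot ℕ) ∧ G.degree = ((n + 2 : ℕ) : WithBot ℕ) ∧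
      (t : ℕ∞) ≤ {C | Lienard.IsHyperellipticLimitCycleOn F G
        (P * (Polynomial.X - Polynomial.C s)) (Q * (Polynomial.X - Polynomial.C s) ^ 2) C}.encard ∧
      ∃ c : ℝ, Lienard.IsSystemOfType (m + 1) (n + 2)
        (F.comp (Polynomial.X + Polynomial.C c)) (G.comp (Polynomial.X + Polynomial.C c)) := by
    filter_upwards [Filter.eventually_all.2 fun i => Filter.eventually_gt_atTop (s₂ i),
      Filter.eventually_all.2 fun i => (hoval i).eventually_integral_ne_zero hP f]
      with s hs hI
    have hrels := hrel.mul_linear s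
    have hF := hrel.degree_damping hf s
    have hG := hrel.degree_restoring hg s
    refine ⟨_, _, hrels, hF, hG, ?_, s, ?_, ?_, ?_⟩
    · have hovals := fun i => (hoval i).mul_linear (hs i)
      set S : Fin t → Set (ℝ × ℝ) := fun i => Lienard.stripCurve
        (P * (Polynomial.X - Polynomial.C s)) (Q * (Polynomial.X - Polynomial.C s) ^ 2)
        (s₁ i) (s₂ i) with hS
      have hinj : Function.Injective S := by
        intro i j hij
        have hIcc : Set.Icc (s₁ i) (s₂ i) = Set.Icc (s₁ j) (s₂ j) := by
          rw [← (hovals i).image_fst_stripCurve, ← (hovals j).image_fst_stripCurve]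
          exact congrArg _ hij
        apply hO
        rw [hOeq i, hOeq j, Lienard.stripCurve, Lienard.stripCurve, hIcc]
      calc (t : ℕ∞) = (Set.range S).encard := by
            rw [← Set.image_univ, hinj.encard_image]
            simp
        _ ≤ _ := by
          refine Set.encard_le_encard ?_
          rintro _ ⟨i, rfl⟩
          exact ⟨(hovals i).isLimitCycle hrels (hI i), hrels.isInvariantCurve, fun z hz => hz.1⟩
    · rw [← hF, ← Polynomial.taylor_apply, Polynomial.degree_taylor]
    · rw [← hG, ← Polynomial.taylor_apply, Polynomial.degree_taylor]
    · simp
  refine ⟨?_, hlarge⟩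
  obtain ⟨s, F, G, hrels, -, -, ht, c, hc⟩ := hlarge.exists
  refine ⟨_, _, hc, ht.trans ?_⟩
  have hinj : Function.Injective ((· - ((c, 0) : ℝ × ℝ)) '' · : Set (ℝ × ℝ) → Set (ℝ × ℝ)) :=
    (sub_left_injective).image_injective
  rw [← hinj.encard_image]
  refine Set.encard_le_encard ?_
  rintro _ ⟨C, hC, rfl⟩
  exact ⟨_, _, Lienard.IsHyperellipticLimitCycleOn.translate hrels hC c⟩
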